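/- **Main Theorem.** Let $X$ be a nonempty compact Hausdorff space of weight at most $\aleph_1$ (that is, the least cardinality of a base for the topology of $X$ is at most $\aleph_1$), and let $f\colon X\to X$ be continuous. Let $\omega^*=\beta\omega\setminus\omega$ be the space of free ultrafilters on $\omega$, with the subspace topology from $\beta\omega$, and let $\sigma\colon\omega^*\to\omega^*$ be the shift map, which sends $p$ to the ultrafilter generated by $\{A+1 : A\in p\}$. Then the following are equivalent: 1. $(X,f)$ is a quotient of $(\omega^*,\sigma)$, i.e. there is a continuous surjection $Q\colon\omega^*\to X$ with $Q\circ\sigma=f\circ Q$; 2. $f$ is weakly incompressible, i.e. for every open $U\subseteq X$ with $\emptyset\neq U\neq X$ we have $f(\overline{U})\not\subseteq U$. -/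

import Mathlib

open Topology Cardinal

universe u v

namespace OmegaStar

/-- `ω* = βω \ ω`: the free (nonprincipal) ultrafilters on `ω = ℕ`, with the subspace topology
inherited from the space `Ultrafilter ℕ = βω` of all ultrafilters on `ℕ`. -/
abbrev Remainder : Type := {p : Ultrafilter ℕ // p ∉ Set.range (pure : ℕ → Ultrafilter ℕ)}

/-- The shift map on `βω`: `p` goes to the ultrafilter generated by `{A + 1 : A ∈ p}`. -/
def shiftBeta (p : Ultrafilter ℕ) : Ultrafilter ℕ := p.map (fun n => n + 1)

theorem shiftBeta_free {p : Ultrafilter ℕ} (hp : p ∉ Set.range (pure : ℕ → Ultrafilter ℕ)) :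
    shiftBeta p ∉ Set.range (pure : ℕ → Ultrafilter ℕ) := by
  rintro ⟨n, hn⟩
  have h1 : ({n} : Set ℕ) ∈ shiftBeta p := by
    rw [← hn]
    exact Set.mem_singleton n
  have h2 : (fun k : ℕ => k + 1) ⁻¹' {n} ∈ p := h1
  have h3 : ((fun k : ℕ => k + 1) ⁻¹' {n}).Finite :=
    (Set.finite_singleton n).preimage (add_left_injective 1).injOn
  obtain ⟨x, -, hx⟩ := Ultrafilter.eq_pure_of_finite_mem h3 h2
  exact hp ⟨x, hx.symm⟩

/-- The shift map `σ` on `ω*`. -/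
def shift (p : Remainder) : Remainder := ⟨shiftBeta p.1, shiftBeta_free p.2⟩

/-- `(Y, g)` is a quotient of `(X, f)`: there is a continuous surjection `Q : X → Y` with
`Q ∘ f = g ∘ Q`. -/
def IsQuotientOf {Y : Type u} {X : Type v} [TopologicalSpace Y] [TopologicalSpace X]
    (g : Y → Y) (f : X → X) : Prop :=
  ∃ Q : X → Y, Continuous Q ∧ Function.Surjective Q ∧ Q ∘ f = g ∘ Q

/-- `f` is weakly incompressible: `f (closure U) ⊈ U` for every open `U` with `∅ ≠ U ≠ X`. -/
def WeaklyIncompressible {X : Type u} [TopologicalSpace X] (f : X → X) : Prop :=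
  ∀ U : Set X, IsOpen U → U ≠ ∅ → U ≠ Set.univ → ¬ f '' closure U ⊆ U

/-- The weight of a topological space: the least cardinality of a base of its topology. -/
noncomputable def weight (X : Type u) [TopologicalSpace X] : Cardinal.{u} :=
  sInf {κ : Cardinal.{u} | ∃ B : Set (Set X), TopologicalSpace.IsTopologicalBasis B ∧ #B = κ}

end OmegaStar

/-!
If `U` is open and `σ(closure U) ⊆ U`, compactness gives `A ⊆ ω` with `σ(closure U) ⊆ A* ⊆ U`. Such
an `A` is eventually closed under successors, hence finite or cofinite, so `U` is empty or `ω*`.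
Thus the shift is weakly incompressible, and this property passes to quotients.

Conversely, encode `x : X` by the family of truth values `x ∈ U i`, where `U` enumerates a base of
size at most `ℵ₁`. Weak incompressibility makes every digraph of patterns on finitely many `U i`
strongly connected. It suffices to find a sequence `h` of patterns which, on each finite set of
indices, is eventually a walk visiting every realized pattern infinitely often: limits of `h` along
free ultrafilters then define the quotient map. For countably many indices such a sequence is built
directly by concatenating paths. For `ℵ₁` many it is built by transfinite extension along countable
sets of indices that are elementary in the sense of Löwenheim–Skolem: new indices are handled by
copying old ones of the same finite type, and the successive approximations are spliced together at
the infinitely many times at which the sequence passes through the pattern of a fixed base point.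
-/

namespace OmegaStar

open Filter Set

/-! ### Tours of finite digraphs -/

section Tours

variable {X P P' : Type*} {E : Set X → Set X → Prop} {π π' : X → P}

/-- The digraph on the values of `π` that a relation `E` between subsets of `X` induces through
the fibres. -/
def FiberRel (E : Set X → Set X → Prop) (π : X → P) (p q : P) : Prop := E (π ⁻¹' {p}) (π ⁻¹' {q})

/-- The sequence `g` is, up to finitely many terms, a walk in the digraph `FiberRel E π` on
`range π`, and it visits every vertex infinitely often. -/
structure IsTour (E : Set X → Set X → Prop) (π : X → P) (g : ℕ → P) : Prop where
  mem_range : ∀ᶠ k in atTop, g k ∈ range π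
  walk : ∀ᶠ k in atTop, FiberRel E π (g k) (g (k + 1))
  visit : ∀ p ∈ range π, ∃ᶠ k in atTop, g k = p

/-- The isomorphism type of the digraph on `range π`, rooted at the value of the base point
`x₀`. -/
def profile (E : Set X → Set X → Prop) (x₀ : X) (π : X → P) : Set P × (P → P → Prop) × P :=
  (range π, FiberRel E π, π x₀)

theorem FiberRel.map (hE : Monotone (Function.uncurry E)) (ρ : P → P') {p q : P}
    (h : FiberRel E π p q) : FiberRel E (ρ ∘ π) (ρ p) (ρ q) := by
  have hfiber (p : P) : π ⁻¹' {p} ⊆ ρ ∘ π ⁻¹' {ρ p} := fun _ hx => congrArg ρ hx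
  exact hE (Prod.mk_le_mk.2 ⟨hfiber p, hfiber q⟩) h

theorem IsTour.map (hE : Monotone (Function.uncurry E)) (ρ : P → P') {g : ℕ → P}
    (hg : IsTour E π g) : IsTour E (ρ ∘ π) (ρ ∘ g) where
  mem_range := hg.mem_range.mono fun _ ⟨x, hx⟩ => ⟨x, congrArg ρ hx⟩
  walk := hg.walk.mono fun _ hk => hk.map hE ρ
  visit := by
    rintro _ ⟨x, rfl⟩
    exact (hg.visit _ ⟨x, rfl⟩).mono fun _ hk => congrArg ρ hk

theorem IsTour.congr {g g' : ℕ → P} (hg : IsTour E π g) (h : g =ᶠ[atTop] g') :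
    IsTour E π g' where
  mem_range := by
    filter_upwards [hg.mem_range, h] with k hk heq
    exact heq ▸ hk
  walk := by
    filter_upwards [hg.walk, h, (tendsto_add_atTop_nat 1).eventually h] with k hk heq heq'
    rwa [← heq, ← heq']
  visit p hp := ((hg.visit p hp).and_eventually h).mono fun _ hk => hk.2.symm.trans hk.1

theorem IsTour.of_profile_eq {x₀ : X} {g : ℕ → P} (hg : IsTour E π g)
    (h : profile E x₀ π = profile E x₀ π') : IsTour E π' g := by
  obtain ⟨hrange, hrel, -⟩ : range π = range π' ∧ FiberRel E π = FiberRel E π' ∧ π x₀ = π' x₀ := by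
    simpa only [profile, Prod.mk.injEq] using h
  exact ⟨hrange ▸ hg.mem_range, hrel ▸ hg.walk, hrange ▸ hg.visit⟩

theorem profile_equiv_comp {x₀ : X} (e : P ≃ P') (h : profile E x₀ π = profile E x₀ π') :
    profile E x₀ (e ∘ π) = profile E x₀ (e ∘ π') := by
  have hcomp (π : X → P) : profile E x₀ (e ∘ π) = (e '' (profile E x₀ π).1,
      fun p q => (profile E x₀ π).2.1 (e.symm p) (e.symm q), e (profile E x₀ π).2.2) := by
    have hfiber (p : P') : e ∘ π ⁻¹' {p} = π ⁻¹' {e.symm p} := by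
      ext x
      simp [Equiv.eq_symm_apply]
    have hrel : FiberRel E (e ∘ π) = fun p q => FiberRel E π (e.symm p) (e.symm q) := by
      funext p q
      simp only [FiberRel, hfiber]
    simp only [profile, range_comp, hrel, Function.comp_apply]
  rw [hcomp, hcomp, h]

end Tours

/-! ### Countable choices -/

section Countability

theorem exists_countable_set_meeting_fibers {α γ : Type*} [Countable γ] (f : α → γ) :
    ∃ s : Set α, s.Countable ∧ ∀ a, ∃ b ∈ s, f b = f a :=
  ⟨range (rangeSplitting f), countable_range _, fun a =>
    ⟨_, mem_range_self ⟨f a, a, rfl⟩, apply_rangeSplitting f _⟩⟩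

theorem exists_seq_frequently_eq {X : Type*} [Nonempty X] {P : ℕ → Type*} [∀ n, Countable (P n)]
    (π : ∀ n, X → P n) : ∃ p : ℕ → X, ∀ n x, ∃ᶠ j in atTop, π n (p j) = π n x := by
  choose D hD hDπ using fun n => exists_countable_set_meeting_fibers (π n)
  obtain ⟨d, hd⟩ := (countable_iUnion hD).exists_eq_range <| by
    obtain ⟨b, hb, -⟩ := hDπ 0 (Classical.arbitrary X)
    exact ⟨b, mem_iUnion_of_mem 0 hb⟩
  refine ⟨fun j => d j.unpair.1, fun n x => frequently_atTop.2 fun a => ?_⟩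
  obtain ⟨b, hb, hbx⟩ := hDπ n x
  obtain ⟨m, rfl⟩ : b ∈ range d := hd ▸ mem_iUnion_of_mem n hb
  exact ⟨Nat.pair m a, Nat.right_le_pair m a, by simpa using hbx⟩

theorem exists_monotone_seq_finset_exhausting {ι : Type*} {T : Set ι} (hT : T.Countable) :
    ∃ K : ℕ → Finset ι, Monotone K ∧ ∀ F : Finset ι, (F : Set ι) ⊆ T → ∃ n, F ⊆ K n := by
  classical
  have := hT.to_subtype
  obtain ⟨K, hK, hlim⟩ := exists_seq_monotone_tendsto_atTop_atTop (Finset T)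
  refine ⟨fun n => (K n).map (Function.Embedding.subtype _), fun m n hmn =>
    Finset.map_subset_map.2 (hK hmn), fun F hF => ?_⟩
  obtain ⟨n, hn⟩ := (hlim.eventually_ge_atTop (F.subtype (· ∈ T))).exists
  exact ⟨n, (Finset.subtype_map_of_mem hF).ge.trans (Finset.map_subset_map.2 hn)⟩

theorem exists_linearOrder_countable_Iic {ι : Type*} (hι : #ι ≤ ℵ₁) :
    ∃ _ : LinearOrder ι, ∀ a : ι, (Iic a).Countable := by
  obtain ⟨_, _, hord⟩ := Cardinal.exists_ord_eq_type_lt ι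
  refine ⟨inferInstance, fun a => ?_⟩
  rw [← Iio_insert, countable_insert, ← Cardinal.le_aleph0_iff_set_countable,
    ← Cardinal.lt_aleph_one_iff]
  exact (Cardinal.mk_Iio_lt a hord).trans_le hι

theorem exists_countable_superset_closed {ι : Type*} {W : Finset ι → Set ι}
    (hW : ∀ F, (W F).Countable) {D : Set ι} (hD : D.Countable) :
    ∃ T, D ⊆ T ∧ T.Countable ∧ ∀ F : Finset ι, (F : Set ι) ⊆ T → W F ⊆ T := by
  let enlarge (C : Set ι) : Set ι := C ∪ ⋃ F ∈ {F : Finset ι | (F : Set ι) ⊆ C}, W F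
  have hcount : ∀ n, (enlarge^[n] D).Countable := fun n => by
    induction n with
    | zero => exact hD
    | succ n ih =>
      rw [Function.iterate_succ_apply']
      refine ih.union (Countable.biUnion ?_ fun F _ => hW F)
      refine (countable_ofPred_finite_subset ih).preimage_of_injOn
        (f := fun F : Finset ι => (F : Set ι)) Finset.coe_injective.injOn |>.mono ?_
      exact fun F hF => ⟨F.finite_toSet, hF⟩
  have hmono : Monotone fun n => enlarge^[n] D :=
    monotone_nat_of_le_succ fun n => by
      rw [Function.iterate_succ_apply']
      exact subset_union_left
  refine ⟨⋃ n, enlarge^[n] D, subset_iUnion_of_subset 0 subset_rfl, countable_iUnion hcount,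
    fun F hF => ?_⟩
  obtain ⟨n, hn⟩ := hmono.directed_le.exists_mem_subset_of_finset_subset_biUnion hF
  refine subset_iUnion_of_subset (n + 1) ?_
  rw [Function.iterate_succ_apply']
  exact subset_union_of_subset_right (subset_biUnion_of_mem (u := W) hn) _

end Countability

/-! ### Splicing tours -/

section Splicing

variable {X ι β : Type*} {E : Set X → Set X → Prop} {φ : X → ι → β} {K : ℕ → Finset ι}

theorem exists_blockIndex {t : ℕ → ℕ} (ht : StrictMono t) :
    ∃ j : ℕ → ℕ, Tendsto j atTop atTop ∧ (∀ n, ∀ k ∈ Ico (t n) (t (n + 1)), j k = n) ∧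
      ∀ᶠ k in atTop, k ∈ Ico (t (j k)) (t (j k + 1)) := by
  let j (k : ℕ) : ℕ := Nat.findGreatest (fun n => t n ≤ k) k
  have hle {n k : ℕ} (h : t n ≤ k) : n ≤ j k := Nat.le_findGreatest (ht.le_apply.trans h) h
  refine ⟨j, tendsto_atTop.2 fun n => (eventually_ge_atTop (t n)).mono fun k => hle,
    fun n k hk => ?_, (eventually_ge_atTop (t 0)).mono fun k hk => ⟨?_, ?_⟩⟩
  · refine Nat.findGreatest_eq_iff.2 ⟨ht.le_apply.trans hk.1, fun _ => hk.1, fun m hm _ hmk => ?_⟩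
    exact ((ht.monotone (Nat.succ_le_of_lt hm)).trans hmk).not_gt hk.2
  · exact Nat.findGreatest_spec (P := fun n => t n ≤ k) (Nat.zero_le k) hk
  · by_contra! h
    exact (hle h).not_gt (Nat.lt_succ_self _)

theorem exists_isTour_of_blocks (hE : Monotone (Function.uncurry E)) (hK : Monotone K)
    {t : ℕ → ℕ} (ht : StrictMono t) {g : ℕ → ℕ → ι → β} {p : ℕ → X}
    (hp : ∀ n x, ∃ᶠ j in atTop, (K n).restrict (φ (p j)) = (K n).restrict (φ x))
    (hrange : ∀ n, ∀ k ∈ Ico (t n) (t (n + 1)),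
      (K n).restrict (g n k) ∈ range ((K n).restrict ∘ φ))
    (hwalk : ∀ n, ∀ k ∈ Ico (t n) (t (n + 1)), FiberRel E ((K n).restrict ∘ φ)
      ((K n).restrict (g n k)) ((K n).restrict (g n (k + 1))))
    (hvisit : ∀ n, ∃ k ∈ Ico (t n) (t (n + 1)),
      (K n).restrict (g n k) = (K n).restrict (φ (p n)))
    (hjoin : ∀ n, (K n).restrict (g n (t (n + 1))) = (K n).restrict (g (n + 1) (t (n + 1)))) :
    ∃ j : ℕ → ℕ, Tendsto j atTop atTop ∧
      ∀ n, IsTour E ((K n).restrict ∘ φ) fun k => (K n).restrict (g (j k) k) := by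
  obtain ⟨j, hj, hblock, hmem⟩ := exists_blockIndex ht
  have hnext : ∀ n, ∀ k ∈ Ico (t n) (t (n + 1)),
      (K n).restrict (g (j (k + 1)) (k + 1)) = (K n).restrict (g n (k + 1)) := by
    intro n k hk
    rcases (Nat.succ_le_of_lt hk.2).lt_or_eq with hlt | heq
    · rw [hblock n (k + 1) ⟨hk.1.trans k.le_succ, hlt⟩]
    · rw [hblock (n + 1) (k + 1) ⟨heq.ge, heq.trans_lt (ht (Nat.lt_succ_self _))⟩]
      simpa only [← heq] using (hjoin n).symm
  refine ⟨j, hj, fun n => ⟨?_, ?_, ?_⟩⟩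
  · filter_upwards [hmem, hj.eventually_ge_atTop n] with k hk hn
    obtain ⟨x, hx⟩ := hrange _ k hk
    exact ⟨x, congrArg (Finset.restrict₂ (π := fun _ => β) (hK hn)) hx⟩
  · filter_upwards [hmem, hj.eventually_ge_atTop n] with k hk hn
    exact (hnext _ k hk ▸ hwalk _ k hk).map hE (Finset.restrict₂ (π := fun _ => β) (hK hn))
  · rintro _ ⟨x, rfl⟩
    refine frequently_atTop.2 fun a => ?_
    obtain ⟨m, hm, hpm⟩ := frequently_atTop.1 (hp n x) (max a n)
    obtain ⟨k, hk, hkm⟩ := hvisit m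
    refine ⟨k, (le_of_max_le_left hm).trans (ht.le_apply.trans hk.1), ?_⟩
    rw [hblock m k hk]
    exact (congrArg (Finset.restrict₂ (π := fun _ => β) (hK (le_of_max_le_right hm))) hkm).trans hpm

theorem exists_isTour_of_frequently_eq [Nonempty X] [Countable β]
    (hE : Monotone (Function.uncurry E)) (hK : Monotone K) {g : ℕ → ℕ → ι → β}
    (hg : ∀ n, IsTour E ((K n).restrict ∘ φ) ((K n).restrict ∘ g n))
    (hmeet : ∀ n, ∃ᶠ k in atTop, (K n).restrict (g n k) = (K n).restrict (g (n + 1) k)) :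
    ∃ j : ℕ → ℕ, Tendsto j atTop atTop ∧
      ∀ n, IsTour E ((K n).restrict ∘ φ) fun k => (K n).restrict (g (j k) k) := by
  obtain ⟨p, hp⟩ := exists_seq_frequently_eq fun n => (K n).restrict ∘ φ
  let IsStep (n k : ℕ) : Prop := (K n).restrict (g n k) ∈ range ((K n).restrict ∘ φ) ∧
    FiberRel E ((K n).restrict ∘ φ) ((K n).restrict (g n k)) ((K n).restrict (g n (k + 1)))
  have hwalk (n : ℕ) : ∀ᶠ s in atTop, ∀ k ≥ s, IsStep n k :=
    eventually_forall_ge_atTop.2 ((hg n).mem_range.and (hg n).walk)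
  have hsucc (n s : ℕ) : ∃ s' > s,
      (∃ k ∈ Ico s s', (K n).restrict (g n k) = (K n).restrict (φ (p n))) ∧
      (K n).restrict (g n s') = (K n).restrict (g (n + 1) s') ∧ ∀ k ≥ s', IsStep (n + 1) k := by
    obtain ⟨k, hsk, hk⟩ := frequently_atTop.1 ((hg n).visit _ (mem_range_self (p n))) s
    obtain ⟨s', hs', hks', hwalk'⟩ :=
      ((hmeet n).and_eventually ((eventually_gt_atTop k).and (hwalk (n + 1)))).exists
    exact ⟨s', hsk.trans_lt hks', ⟨k, ⟨hsk, hks'⟩, hk⟩, hs', hwalk'⟩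
  choose succTime hlt hvisit hjoin hsucc using hsucc
  obtain ⟨t₀, ht₀⟩ := (hwalk 0).exists
  let t (n : ℕ) : ℕ := Nat.rec t₀ succTime n
  have hgood : ∀ n, ∀ k ≥ t n, IsStep n k
    | 0 => ht₀
    | n + 1 => hsucc n (t n)
  exact exists_isTour_of_blocks hE hK (strictMono_nat_of_lt_succ fun n => hlt n (t n)) hp
    (fun n k hk => (hgood n k hk.1).1) (fun n k hk => (hgood n k hk.1).2)
    (fun n => hvisit n (t n)) fun n => hjoin n (t n)

theorem exists_path_of_transGen {r : X → X → Prop} {x y : X} (h : Relation.TransGen r x y) :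
    ∃ (m : ℕ) (w : ℕ → X), 0 < m ∧ w 0 = x ∧ w m = y ∧ ∀ k < m, r (w k) (w (k + 1)) := by
  induction h with
  | @single y h =>
    refine ⟨1, fun k => if k = 0 then x else y, one_pos, rfl, rfl, fun k hk => ?_⟩
    obtain rfl : k = 0 := Nat.lt_one_iff.1 hk
    simpa using h
  | @tail y z _ h ih =>
    obtain ⟨m, w, hm, h0, hwm, hw⟩ := ih
    refine ⟨m + 1, fun k => if k ≤ m then w k else z, Nat.succ_pos m, by simpa using h0, by simp,
      fun k hk => ?_⟩
    rcases (Nat.lt_succ_iff.1 hk).lt_or_eq with hk | rfl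
    · simpa [hk.le, Nat.succ_le_of_lt hk] using hw k hk
    · simpa [hwm] using h

/-- Up to finitely many terms, the sequence `h` of points of `ι → β` looks on every finite set of
coordinates in `S` like a tour of the space encoded by `φ`. -/
def IsTraceOn (E : Set X → Set X → Prop) (φ : X → ι → β) (h : ℕ → ι → β) (S : Set ι) : Prop :=
  ∀ F : Finset ι, (F : Set ι) ⊆ S → IsTour E (F.restrict ∘ φ) (F.restrict ∘ h)

variable {h : ℕ → ι → β} {S T : Set ι}

theorem isTraceOn_of_exhaustion (hE : Monotone (Function.uncurry E))
    (hS : ∀ F : Finset ι, (F : Set ι) ⊆ S → ∃ n, F ⊆ K n)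
    (hh : ∀ n, IsTour E ((K n).restrict ∘ φ) ((K n).restrict ∘ h)) : IsTraceOn E φ h S :=
  fun F hF => (hS F hF).elim fun n hn => (hh n).map hE (Finset.restrict₂ (π := fun _ => β) hn)

theorem IsTraceOn.isTour_comp (hE : Monotone (Function.uncurry E)) (hh : IsTraceOn E φ h S)
    {F : Finset ι} {τ : ι → ι} (hτ : ∀ i ∈ F, τ i ∈ S) :
    IsTour E (fun x => F.restrict (φ x ∘ τ)) fun k => F.restrict (h k ∘ τ) := by
  classical
  have hF : ((F.image τ : Finset ι) : Set ι) ⊆ S := by simpa [subset_def] using hτ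
  exact (hh (F.image τ) hF).map hE fun v (i : F) => v ⟨τ i, Finset.mem_image_of_mem τ i.2⟩

theorem exists_isTraceOn_of_countable [Nonempty X] [Countable β]
    (hE : Monotone (Function.uncurry E))
    (hconn : ∀ (F : Finset ι) x y, Relation.TransGen (fun x y =>
      FiberRel E (F.restrict ∘ φ) (F.restrict (φ x)) (F.restrict (φ y))) x y)
    (hT : T.Countable) : ∃ h, IsTraceOn E φ h T := by
  obtain ⟨K, hK, hexh⟩ := exists_monotone_seq_finset_exhausting hT
  obtain ⟨p, hp⟩ := exists_seq_frequently_eq fun n => (K n).restrict ∘ φ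
  choose m w hm hw0 hwm hw using fun n => exists_path_of_transGen (hconn (K n) (p n) (p (n + 1)))
  let t (n : ℕ) : ℕ := ∑ i ∈ Finset.range n, m i
  have ht (n : ℕ) : t (n + 1) = t n + m n := Finset.sum_range_succ m n
  obtain ⟨j, -, hj⟩ := exists_isTour_of_blocks (t := t) (g := fun n k => φ (w n (k - t n))) hE hK
    (strictMono_nat_of_lt_succ fun n => by simpa [ht] using hm n) hp
    (fun n k _ => ⟨_, rfl⟩)
    (fun n k hk => by
      simpa only [Nat.sub_add_comm hk.1] using
        hw n (k - t n) (Nat.sub_lt_left_of_lt_add hk.1 (ht n ▸ hk.2)))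
    (fun n => ⟨t n, ⟨le_rfl, by simpa [ht] using hm n⟩, by simp [hw0]⟩)
    (fun n => by simp [ht, hwm, hw0])
  exact ⟨_, isTraceOn_of_exhaustion hE hexh hj⟩

end Splicing

/-! ### Elementary sets of coordinates -/

section Elementary

variable {X ι β : Type*} {E : Set X → Set X → Prop} {φ : X → ι → β} {x₀ : X} {S T : Set ι}

/-- A form of the Tarski–Vaught criterion: every finite set `F` of coordinates can be moved into
`S`, fixing the coordinates already in `S`, without changing the profile of the encoding `φ`
restricted to `F`. -/
def IsElementary (E : Set X → Set X → Prop) (φ : X → ι → β) (x₀ : X) (S : Set ι) : Prop :=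
  ∀ F : Finset ι, ∃ τ : ι → ι, (∀ i ∈ F, i ∈ S → τ i = i) ∧ (∀ i ∈ F, τ i ∈ S) ∧
    profile E x₀ (fun x => F.restrict (φ x ∘ τ)) = profile E x₀ (F.restrict ∘ φ)

theorem isElementary_biUnion {κ : Type*} {c : Set κ} (hc : c.Nonempty) {C : κ → Set ι}
    (hdir : DirectedOn (C ⁻¹'o (· ⊆ ·)) c) (hC : ∀ a ∈ c, IsElementary E φ x₀ (C a)) :
    IsElementary E φ x₀ (⋃ a ∈ c, C a) := by
  classical
  intro F
  obtain ⟨a, ha, hFa⟩ := hdir.exists_mem_subset_of_finset_subset_biUnion hc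
    (s := {i ∈ F | i ∈ ⋃ a ∈ c, C a}) fun i hi => (Finset.mem_filter.1 hi).2
  obtain ⟨τ, hfix, hτ, hprof⟩ := hC a ha F
  exact ⟨τ, fun i hi hic => hfix i hi (hFa (by simpa using ⟨hi, by simpa using hic⟩)),
    fun i hi => mem_biUnion ha (hτ i hi), hprof⟩

theorem exists_isElementary_superset [Finite β] (E : Set X → Set X → Prop) (φ : X → ι → β)
    (x₀ : X) [Preorder ι] (hι : ∀ a : ι, (Iic a).Countable) (hS : S.Countable) :
    ∃ T, S ⊆ T ∧ T.Countable ∧ IsLowerSet T ∧ IsElementary E φ x₀ T := by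
  classical
  choose R hR hfib using fun (F : Finset ι) (n : ℕ) => exists_countable_set_meeting_fibers
    fun v : Fin n → ι => (fun m (i : F) => v m = i, profile E x₀ fun x => φ x ∘ v)
  obtain ⟨T, hST, hT, hclosed⟩ := exists_countable_superset_closed
    (W := fun F => (⋃ i ∈ F, Iic i) ∪ ⋃ n, ⋃ w ∈ R F n, range w)
    (fun F => (F.countable_toSet.biUnion fun i _ => hι i).union <| countable_iUnion fun n =>
      (hR F n).biUnion fun w _ => countable_range w) hS
  refine ⟨T, hST, hT, fun a b hba ha => hclosed {a} (by simpa using ha) (.inl (by simpa)),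
    fun F => ?_⟩
  let e := F.equivFin
  obtain ⟨w, hw, hwF⟩ := hfib {i ∈ F | i ∈ T} F.card fun m => e.symm m
  obtain ⟨hfix, hprof⟩ := Prod.mk.inj hwF
  let τ : ι → ι := Function.extend ((↑) : F → ι) (w ∘ e) id
  have hτ (i : F) : τ i = w (e i) := Subtype.val_injective.extend_apply (w ∘ e) id i
  refine ⟨τ, fun i hi hiT => ?_, fun i hi => ?_, ?_⟩
  · have := congrFun (congrFun hfix (e ⟨i, hi⟩)) ⟨i, by simp [hi, hiT]⟩
    simpa [hτ ⟨i, hi⟩] using this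
  · rw [hτ ⟨i, hi⟩]
    exact hclosed {i ∈ F | i ∈ T} (fun i hi => (Finset.mem_filter.1 hi).2)
      (.inr (mem_iUnion.2 ⟨F.card, mem_biUnion hw (mem_range_self _)⟩))
  · convert profile_equiv_comp (e.symm.arrowCongr (Equiv.refl β)) hprof using 2
    · funext x i
      simp [hτ, Equiv.arrowCongr]
    · funext x i
      simp [Equiv.arrowCongr]

theorem IsElementary.exists_extension [Finite β] (hE : Monotone (Function.uncurry E))
    (hS : IsElementary E φ x₀ S) (hT : T.Countable) {h : ℕ → ι → β} (hh : IsTraceOn E φ h S) :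
    ∃ h' : ℕ → ι → β, (∀ k, EqOn (h' k) (h k) S) ∧ IsTraceOn E φ h' T := by
  classical
  have : Nonempty X := ⟨x₀⟩
  obtain ⟨K, hK, hexh⟩ := exists_monotone_seq_finset_exhausting hT
  choose τ hfix hτ hprof using fun n => hS (K n)
  have hroot (n : ℕ) (i : ι) (hi : i ∈ K n) : φ x₀ (τ n i) = φ x₀ i :=
    congrFun (congrArg (fun q => q.2.2) (hprof n)) ⟨i, hi⟩
  -- The profiles keep track of `x₀`, so successive sequences meet whenever `h` passes through it.
  have hmeet (n : ℕ) : ∃ᶠ k in atTop,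
      (K n).restrict (h k ∘ τ n) = (K n).restrict (h k ∘ τ (n + 1)) := by
    let F := (K n).image (τ n) ∪ (K (n + 1)).image (τ (n + 1))
    have hF : (F : Set ι) ⊆ S := by
      simpa [F, subset_def, or_imp, forall_and] using ⟨hτ n, hτ (n + 1)⟩
    refine ((hh F hF).visit _ (mem_range_self x₀)).mono fun k hk => funext fun i => ?_
    have hk (l : ι) (hl : l ∈ F) : h k l = φ x₀ l := congrFun hk ⟨l, hl⟩
    have hi : (i : ι) ∈ K (n + 1) := hK n.le_succ i.2
    calc h k (τ n i) = φ x₀ (τ n i) :=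
          hk _ (Finset.mem_union_left _ (Finset.mem_image_of_mem _ i.2))
      _ = φ x₀ (τ (n + 1) i) := (hroot n i i.2).trans (hroot (n + 1) i hi).symm
      _ = h k (τ (n + 1) i) :=
          (hk _ (Finset.mem_union_right _ (Finset.mem_image_of_mem _ hi))).symm
  obtain ⟨j, hj, htour⟩ := exists_isTour_of_frequently_eq hE hK
    (fun n => ((hh.isTour_comp hE (hτ n)).of_profile_eq (hprof n))) hmeet
  refine ⟨fun k => S.piecewise (h k) (h k ∘ τ (j k)), fun k => S.piecewise_eqOn _ _,
    isTraceOn_of_exhaustion hE hexh fun n => (htour n).congr ?_⟩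
  filter_upwards [hj.eventually_ge_atTop n] with k hk
  funext i
  by_cases hi : (i : ι) ∈ S
  · simp [hi, hfix (j k) i (hK hk i.2) hi]
  · simp [hi]

end Elementary

/-! ### Traces on `ℵ₁` many coordinates -/

section PartialTrace

variable {X ι β : Type*} {E : Set X → Set X → Prop} {φ : X → ι → β} {x₀ : X}

/-- A trace on an elementary initial segment of the coordinates. Initial segments are required so
that proper ones are countable when `ι` has order type at most `ω₁`. -/
structure PartialTrace (E : Set X → Set X → Prop) (φ : X → ι → β) (x₀ : X) [LE ι] where
  carrier : Set ι
  seq : ℕ → ι → β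
  isLowerSet : IsLowerSet carrier
  isElementary : IsElementary E φ x₀ carrier
  isTraceOn : IsTraceOn E φ seq carrier

namespace PartialTrace

instance [LE ι] : Preorder (PartialTrace E φ x₀) where
  le p q := p.carrier ⊆ q.carrier ∧ ∀ k, EqOn (q.seq k) (p.seq k) p.carrier
  le_refl p := ⟨subset_rfl, fun k => eqOn_refl _ _⟩
  le_trans p q r hpq hqr :=
    ⟨hpq.1.trans hqr.1, fun k => ((hqr.2 k).mono hpq.1).trans (hpq.2 k)⟩

theorem bddAbove_of_isChain [LE ι] {c : Set (PartialTrace E φ x₀)} (hc : IsChain (· ≤ ·) c)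
    (hne : c.Nonempty) : BddAbove c := by
  have hdir : DirectedOn (carrier ⁻¹'o (· ⊆ ·)) c :=
    hc.directedOn.mono fun _ _ hpq => hpq.1
  have hglue (i : ι) : ∃ v : ℕ → β, ∀ p ∈ c, i ∈ p.carrier → ∀ k, p.seq k i = v k := by
    by_cases hi : ∃ p ∈ c, i ∈ p.carrier
    · obtain ⟨p, hp, hip⟩ := hi
      refine ⟨fun k => p.seq k i, fun q hq hiq k => ?_⟩
      rcases hc.total hp hq with hpq | hqp
      · exact hpq.2 k hip
      · exact (hqp.2 k hiq).symm
    · exact ⟨fun k => hne.some.seq k i, fun p hp hip => (hi ⟨p, hp, hip⟩).elim⟩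
  choose v hv using hglue
  refine ⟨⟨⋃ p ∈ c, p.carrier, fun k i => v i k, isLowerSet_iUnion₂ fun p _ => p.isLowerSet,
    isElementary_biUnion hne hdir fun p _ => p.isElementary, fun F hF => ?_⟩,
    fun p hp => ⟨subset_biUnion_of_mem (u := carrier) hp, fun k i hi => (hv i p hp hi k).symm⟩⟩
  obtain ⟨p, hp, hFp⟩ := hdir.exists_mem_subset_of_finset_subset_biUnion hne hF
  exact (p.isTraceOn F hFp).congr <| .of_forall fun k => funext fun i => hv i p hp (hFp i.2) k

theorem carrier_eq_univ_of_isMax [Finite β] (hE : Monotone (Function.uncurry E)) [LinearOrder ι]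
    (hι : ∀ a : ι, (Iic a).Countable) {p : PartialTrace E φ x₀} (hp : IsMax p) :
    p.carrier = Set.univ := by
  by_contra hne
  obtain ⟨a, ha⟩ := (ne_univ_iff_exists_notMem _).1 hne
  have hcount : (insert a p.carrier).Countable := ((hι a).mono fun b hb =>
    le_of_not_ge fun hab => ha (p.isLowerSet hab hb)).insert a
  obtain ⟨T, hpT, hT, hlower, helem⟩ := exists_isElementary_superset E φ x₀ hι hcount
  obtain ⟨h, hext, hh⟩ := p.isElementary.exists_extension hE hT p.isTraceOn
  exact ha ((hp (b := ⟨T, h, hlower, helem, hh⟩)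
    ⟨(subset_insert _ _).trans hpT, hext⟩).1 (hpT (mem_insert _ _)))

end PartialTrace

theorem exists_isTraceOn_univ [Nonempty X] [Finite β] (hE : Monotone (Function.uncurry E))
    (hconn : ∀ (F : Finset ι) x y, Relation.TransGen (fun x y =>
      FiberRel E (F.restrict ∘ φ) (F.restrict (φ x)) (F.restrict (φ y))) x y)
    (hι : #ι ≤ ℵ₁) : ∃ h, IsTraceOn E φ h Set.univ := by
  obtain ⟨_, hIic⟩ := exists_linearOrder_countable_Iic hι
  obtain ⟨x₀⟩ := ‹Nonempty X›
  obtain ⟨T, -, hT, hlower, helem⟩ := exists_isElementary_superset E φ x₀ hIic countable_empty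
  obtain ⟨h, hh⟩ := have : Nonempty X := ⟨x₀⟩; exists_isTraceOn_of_countable hE hconn hT
  have : Nonempty (PartialTrace E φ x₀) := ⟨⟨T, h, hlower, helem, hh⟩⟩
  obtain ⟨p, hp⟩ : ∃ p : PartialTrace E φ x₀, IsMax p :=
    zorn_le_nonempty fun _ hc hne => PartialTrace.bddAbove_of_isChain hc hne
  exact ⟨p.seq, p.carrier_eq_univ_of_isMax hE hIic hp ▸ p.isTraceOn⟩

end PartialTrace

/-! ### Weak incompressibility -/

section WeakIncompressibility

variable {X Y P : Type*} [TopologicalSpace X] [TopologicalSpace Y] {f : X → X} {g : Y → Y}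

theorem WeaklyIncompressible.of_isQuotientOf (hf : WeaklyIncompressible f)
    (h : IsQuotientOf g f) : WeaklyIncompressible g := by
  obtain ⟨Q, hQ, hsurj, hcomm⟩ := h
  intro U hU hne huniv hgU
  refine hf (Q ⁻¹' U) (hU.preimage hQ) ?_ ?_ ?_
  · rwa [Ne, preimage_eq_empty_iff, hsurj.range_eq, disjoint_univ]
  · rwa [Ne, preimage_eq_univ_iff, hsurj.range_eq, univ_subset_iff]
  · rintro _ ⟨x, hx, rfl⟩
    rw [mem_preimage, show Q (f x) = g (Q x) from congrFun hcomm x]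
    exact hgU (mem_image_of_mem g (hQ.closure_preimage_subset U hx))

/-- Some point of the closure of `a` is mapped by `f` into the closure of `b`. -/
def ClosureStep (f : X → X) (a b : Set X) : Prop := (f '' closure a ∩ closure b).Nonempty

theorem monotone_uncurry_closureStep (f : X → X) : Monotone (Function.uncurry (ClosureStep f)) :=
  fun _ _ hab h => h.mono <|
    inter_subset_inter (image_mono (closure_mono hab.1)) (closure_mono hab.2)

theorem exists_mem_closure_fiber [Finite P] (π : X → P) {b : Set X} {z : X} (hz : z ∈ closure b) :
    ∃ y ∈ b, z ∈ closure (π ⁻¹' {π y}) := by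
  have hb : b ⊆ ⋃ p ∈ π '' b, π ⁻¹' {p} := fun y hy =>
    mem_biUnion (mem_image_of_mem π hy) rfl
  have hz' := closure_mono hb hz
  rw [(toFinite _).closure_biUnion] at hz'
  simpa using hz'

theorem WeaklyIncompressible.transGen_fiberRel [Finite P] (hf : WeaklyIncompressible f)
    (π : X → P) (x y : X) :
    Relation.TransGen (fun x y => FiberRel (ClosureStep f) π (π x) (π y)) x y := by
  set r := fun x y => FiberRel (ClosureStep f) π (π x) (π y)
  have hr {x y z : X} (hx : z ∈ closure (π ⁻¹' {π x})) (hy : f z ∈ closure (π ⁻¹' {π y})) : r x y :=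
    ⟨f z, ⟨z, hx, rfl⟩, hy⟩
  let reach : Set X := {y | Relation.TransGen r x y}
  have hreach : f '' closure reach ⊆ interior reach := by
    rintro _ ⟨z, hz, rfl⟩
    by_contra hfz
    rw [← mem_compl_iff, ← closure_compl] at hfz
    obtain ⟨y₁, hy₁, hz₁⟩ := exists_mem_closure_fiber π hz
    obtain ⟨y₂, hy₂, hz₂⟩ := exists_mem_closure_fiber π hfz
    exact hy₂ (.tail hy₁ (hr hz₁ hz₂))
  have hfx : f x ∈ reach := .single (hr (subset_closure rfl) (subset_closure rfl))
  by_contra hxy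
  refine hf (interior reach) isOpen_interior ?_ ?_ ?_
  · exact Nonempty.ne_empty ⟨_, hreach (mem_image_of_mem f (subset_closure hfx))⟩
  · exact fun h => hxy (interior_subset (h ▸ mem_univ y))
  · exact (image_mono (closure_mono interior_subset)).trans hreach

end WeakIncompressibility

/-! ### The shift on `ω*` -/

section Remainder

theorem Remainder.le_atTop (p : Remainder) : (p.1 : Filter ℕ) ≤ atTop := by
  rw [← Nat.cofinite_eq_atTop]
  exact p.1.le_cofinite_or_eq_pure.resolve_right fun ⟨n, hn⟩ => p.2 ⟨n, hn.symm⟩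

theorem Remainder.eventually_atTop_iff {A : ℕ → Prop} :
    (∀ᶠ k in atTop, A k) ↔ ∀ p : Remainder, ∀ᶠ k in p.1, A k := by
  refine ⟨fun h p => h.filter_mono p.le_atTop, fun h => mem_iff_ultrafilter.2 fun p hp => ?_⟩
  refine h ⟨p, ?_⟩
  rintro ⟨n, rfl⟩
  exact hp (eventually_ne_atTop n) rfl

theorem isOpen_range_pure {α : Type*} : IsOpen (range (pure : α → Ultrafilter α)) := by
  refine isOpen_iff_forall_mem_open.2 ?_
  rintro _ ⟨a, rfl⟩
  refine ⟨{p | ({a} : Set α) ∈ p}, fun p hp => ?_, ultrafilter_isOpen_basic _, mem_singleton a⟩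
  obtain ⟨b, -, rfl⟩ := Ultrafilter.eq_pure_of_finite_mem (finite_singleton a) hp
  exact mem_range_self b

instance : CompactSpace Remainder :=
  isCompact_iff_compactSpace.1 isOpen_range_pure.isClosed_compl.isCompact

/-- The clopen subset `A*` of `ω*` determined by `A ⊆ ω`. -/
def starSet (A : Set ℕ) : Set Remainder := {p | A ∈ p.1}

theorem isOpen_starSet (A : Set ℕ) : IsOpen (starSet A) :=
  (ultrafilter_isOpen_basic A).preimage continuous_subtype_val

theorem exists_starSet_between {C O : Set Remainder} (hC : IsClosed C) (hO : IsOpen O)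
    (hCO : C ⊆ O) : ∃ A, C ⊆ starSet A ∧ starSet A ⊆ O := by
  refine hC.isCompact.induction_on (p := fun C => ∃ A, C ⊆ starSet A ∧ starSet A ⊆ O) ?_ ?_ ?_ ?_
  · exact ⟨∅, empty_subset _, fun p hp => (p.1.empty_notMem hp).elim⟩
  · rintro C C' hCC' ⟨A, hA, hAO⟩
    exact ⟨A, hCC'.trans hA, hAO⟩
  · rintro C C' ⟨A, hA, hAO⟩ ⟨B, hB, hBO⟩
    have hAB : starSet (A ∪ B) = starSet A ∪ starSet B := ext fun p => Ultrafilter.union_mem_iff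
    exact ⟨A ∪ B, hAB ▸ union_subset_union hA hB, hAB ▸ union_subset hAO hBO⟩
  · intro p hp
    obtain ⟨O', hO', rfl⟩ := isOpen_induced_iff.1 hO
    obtain ⟨_, ⟨A, rfl⟩, hpA, hA⟩ :=
      ultrafilterBasis_is_basis.exists_subset_of_mem_open (hCO hp) hO'
    exact ⟨starSet A, mem_nhdsWithin_of_mem_nhds ((isOpen_starSet A).mem_nhds hpA), A, subset_rfl,
      fun q hq => hA hq⟩

theorem continuous_shift : Continuous shift := by
  have hshift : Continuous shiftBeta := ultrafilterBasis_is_basis.continuous_iff.2 <| by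
    rintro _ ⟨A, rfl⟩
    exact ultrafilter_isOpen_basic ((· + 1) ⁻¹' A)
  exact (hshift.comp continuous_subtype_val).subtype_mk _

theorem eventually_mem_of_frequently_of_succ {A : Set ℕ} (hA : ∃ᶠ k in atTop, k ∈ A)
    (hsucc : ∀ᶠ k in atTop, k ∈ A → k + 1 ∈ A) : ∀ᶠ k in atTop, k ∈ A := by
  obtain ⟨N, hN⟩ := eventually_atTop.1 hsucc
  obtain ⟨a, hNa, ha⟩ := frequently_atTop.1 hA N
  exact eventually_atTop.2 ⟨a, fun k hk =>
    Nat.le_induction ha (fun k hk ih => hN k (hNa.trans hk) ih) k hk⟩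

theorem weaklyIncompressible_shift : WeaklyIncompressible shift := by
  intro U hU hne huniv hshift
  obtain ⟨A, hA, hAU⟩ := exists_starSet_between
    (isClosed_closure.isCompact.image continuous_shift).isClosed hU hshift
  have hmem {p : Remainder} (hp : p ∈ U) : shift p ∈ starSet A :=
    hA (mem_image_of_mem shift (subset_closure hp))
  obtain ⟨p, hp⟩ := nonempty_iff_ne_empty.2 hne
  have hp' : ∀ᶠ k in (shift p).1, k ∈ A := hmem hp
  have hfreq : ∃ᶠ k in atTop, k ∈ A := hp'.frequently.filter_mono (shift p).le_atTop
  have hsucc : ∀ᶠ k in atTop, k ∈ A → k + 1 ∈ A := Remainder.eventually_atTop_iff.2 fun q =>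
    Ultrafilter.eventually_imp.2 fun hq => hmem (hAU hq)
  have hall := eventually_mem_of_frequently_of_succ hfreq hsucc
  exact huniv (eq_univ_of_forall fun q => hAU (Remainder.eventually_atTop_iff.1 hall q))

end Remainder

/-! ### Quotient maps from traces -/

section TraceLimit

variable {X ι : Type*} {U : ι → Set X} {f : X → X} {h : ℕ → ι → Prop}
  {p : Remainder} {x y : X}

/-- The points described by the sequence `h` of membership patterns in the sets `U i` converge
to `x` along `p`. -/
def IsTraceLimit (U : ι → Set X) (h : ℕ → ι → Prop) (p : Remainder) (x : X) : Prop :=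
  ∀ i, x ∈ U i → ∀ᶠ k in p.1, h k i

theorem IsTraceOn.eventually_exists_mem_iff {E : Set X → Set X → Prop}
    (hh : IsTraceOn E (fun x i => x ∈ U i) h Set.univ) (F : Finset ι) (p : Remainder) :
    ∀ᶠ k in p.1, ∃ x, ∀ i ∈ F, x ∈ U i ↔ h k i :=
  ((hh F (subset_univ _)).mem_range.filter_mono p.le_atTop).mono fun _ ⟨x, hx⟩ =>
    ⟨x, fun i hi => (congrFun hx ⟨i, hi⟩).to_iff⟩

variable [TopologicalSpace X]

theorem IsTraceOn.exists_isTraceLimit [CompactSpace X] {E : Set X → Set X → Prop}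
    (hh : IsTraceOn E (fun x i => x ∈ U i) h Set.univ) (hU : ∀ i, IsOpen (U i)) (p : Remainder) :
    ∃ x, IsTraceLimit U h p x := by
  by_contra! hlim
  simp only [IsTraceLimit, not_forall, ← Ultrafilter.eventually_not] at hlim
  choose i hi hip using hlim
  obtain ⟨F, hF⟩ := isCompact_univ.elim_finite_subcover _ (fun x => hU (i x)) fun x _ =>
    mem_iUnion_of_mem x (hi x)
  classical
  obtain ⟨k, hk, x, hx⟩ := (((Finset.eventually_all F).2 fun y _ => hip y).and
    (hh.eventually_exists_mem_iff (F.image i) p)).exists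
  obtain ⟨y, hy, hxy⟩ := mem_iUnion₂.1 (hF (mem_univ x))
  exact hk y hy ((hx _ (Finset.mem_image_of_mem i hy)).1 hxy)

theorem exists_mem_closure_subset [RegularSpace X]
    (hU : TopologicalSpace.IsTopologicalBasis (range U)) {O : Set X} (hO : O ∈ 𝓝 x) :
    ∃ i, x ∈ U i ∧ closure (U i) ⊆ O := by
  obtain ⟨_, ⟨hx, ⟨i, rfl⟩⟩, hi⟩ := (hU.nhds_basis_closure x).mem_iff.1 hO
  exact ⟨i, hx, hi⟩

theorem IsTraceLimit.mem_closure (hU : TopologicalSpace.IsTopologicalBasis (range U))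
    {E : Set X → Set X → Prop} (hh : IsTraceOn E (fun x i => x ∈ U i) h Set.univ)
    (hx : IsTraceLimit U h p x) {i : ι} (hi : ∀ᶠ k in p.1, h k i) : x ∈ closure (U i) := by
  classical
  refine hU.mem_closure_iff.2 ?_
  rintro _ ⟨j, rfl⟩ hj
  obtain ⟨k, ⟨hki, hkj⟩, y, hy⟩ :=
    ((hi.and (hx j hj)).and (hh.eventually_exists_mem_iff {i, j} p)).exists
  exact ⟨y, (hy j (by simp)).2 hkj, (hy i (by simp)).2 hki⟩

theorem IsTraceLimit.eq_of_shift [T3Space X]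
    (hU : TopologicalSpace.IsTopologicalBasis (range U)) (hf : Continuous f)
    (hh : IsTraceOn (ClosureStep f) (fun x i => x ∈ U i) h Set.univ)
    (hx : IsTraceLimit U h p x) (hy : IsTraceLimit U h (shift p) y) : y = f x := by
  classical
  by_contra hne
  obtain ⟨O₁, O₂, hO₁, hO₂, hy₁, hx₂, hdisj⟩ := t2_separation hne
  obtain ⟨j, hj, hjO⟩ := exists_mem_closure_subset hU (hO₁.mem_nhds hy₁)
  obtain ⟨i, hi, hclO⟩ := exists_mem_closure_subset hU ((hO₂.preimage hf).mem_nhds hx₂)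
  have hj' : ∀ᶠ k in p.1, h (k + 1) j := hy j hj
  obtain ⟨k, ⟨hki, hkj⟩, _, ⟨z, hz, rfl⟩, hfz⟩ := (((hx i hi).and hj').and
    ((hh {i, j} (subset_univ _)).walk.filter_mono p.le_atTop)).exists
  have hfiber {m : ℕ} {l : ι} (hl : l ∈ ({i, j} : Finset ι)) (hm : h m l) :
      closure ((({i, j} : Finset ι).restrict ∘ fun x i => x ∈ U i) ⁻¹'
        {Finset.restrict {i, j} (h m)}) ⊆ closure (U l) :=
    closure_mono fun w hw => (congrFun hw ⟨l, hl⟩).mpr hm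
  exact disjoint_left.1 hdisj (hjO (hfiber (by simp) hkj hfz)) (hclO (hfiber (by simp) hki hz))

theorem continuous_of_isTraceLimit [RegularSpace X]
    (hU : TopologicalSpace.IsTopologicalBasis (range U)) {E : Set X → Set X → Prop}
    (hh : IsTraceOn E (fun x i => x ∈ U i) h Set.univ) {Q : Remainder → X}
    (hQ : ∀ p, IsTraceLimit U h p (Q p)) : Continuous Q := by
  refine continuous_iff_continuousAt.2 fun p O hO => mem_map.2 ?_
  obtain ⟨i, hi, hclO⟩ := exists_mem_closure_subset hU hO
  filter_upwards [(isOpen_starSet {k | h k i}).mem_nhds (hQ p i hi)] with q hq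
  exact hclO ((hQ q).mem_closure hU hh hq)

theorem denseRange_of_isTraceLimit [RegularSpace X]
    (hU : TopologicalSpace.IsTopologicalBasis (range U)) {E : Set X → Set X → Prop}
    (hh : IsTraceOn E (fun x i => x ∈ U i) h Set.univ) {Q : Remainder → X}
    (hQ : ∀ p, IsTraceLimit U h p (Q p)) : DenseRange Q := by
  refine fun x => mem_closure_iff_nhds.2 fun O hO => ?_
  obtain ⟨i, hi, hclO⟩ := exists_mem_closure_subset hU hO
  have hfreq : ∃ᶠ k in atTop, h k i :=
    ((hh {i} (subset_univ _)).visit _ (mem_range_self x)).mono fun k hk =>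
      (congrFun hk ⟨i, Finset.mem_singleton_self i⟩).mpr hi
  obtain ⟨p, hp⟩ : ∃ p : Remainder, ∀ᶠ k in p.1, h k i := by
    by_contra! hnone
    exact hfreq (Remainder.eventually_atTop_iff.2 hnone)
  exact ⟨Q p, hclO ((hQ p).mem_closure hU hh hp), mem_range_self p⟩

theorem isQuotientOf_of_isTraceOn [CompactSpace X] [T2Space X]
    (hU : TopologicalSpace.IsTopologicalBasis (range U)) (hf : Continuous f)
    (hh : IsTraceOn (ClosureStep f) (fun x i => x ∈ U i) h Set.univ) : IsQuotientOf f shift := by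
  choose Q hQ using hh.exists_isTraceLimit fun i => hU.isOpen (mem_range_self i)
  have hcont : Continuous Q := continuous_of_isTraceLimit hU hh hQ
  refine ⟨Q, hcont, range_eq_univ.1 ?_, funext fun p => (hQ p).eq_of_shift hU hf hh (hQ (shift p))⟩
  rw [← (denseRange_of_isTraceLimit hU hh hQ).closure_range,
    (isCompact_range hcont).isClosed.closure_eq]

end TraceLimit

theorem exists_isTopologicalBasis_mk_eq_weight (X : Type*) [TopologicalSpace X] :
    ∃ B : Set (Set X), TopologicalSpace.IsTopologicalBasis B ∧ #B = weight X :=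
  csInf_mem (s := {κ | ∃ B : Set (Set X), TopologicalSpace.IsTopologicalBasis B ∧ #B = κ})
    ⟨_, _, TopologicalSpace.isTopologicalBasis_opens, rfl⟩

end OmegaStar

theorem mainTheorem1 {X : Type u} [TopologicalSpace X] [CompactSpace X] [T2Space X] [Nonempty X]
    (hX : OmegaStar.weight X ≤ ℵ₁) (f : X → X) (hf : Continuous f) :
    OmegaStar.IsQuotientOf f OmegaStar.shift ↔ OmegaStar.WeaklyIncompressible f := by
  refine ⟨OmegaStar.weaklyIncompressible_shift.of_isQuotientOf, fun hwi => ?_⟩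
  obtain ⟨B, hB, hcard⟩ := OmegaStar.exists_isTopologicalBasis_mk_eq_weight X
  obtain ⟨h, hh⟩ := OmegaStar.exists_isTraceOn_univ (φ := fun x (U : B) => x ∈ U.1)
    (OmegaStar.monotone_uncurry_closureStep f)
    (fun F => hwi.transGen_fiberRel (F.restrict ∘ fun x (U : B) => x ∈ U.1))
    (hcard.trans_le hX)
  exact OmegaStar.isQuotientOf_of_isTraceOn (by rwa [Subtype.range_coe]) hf hh
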